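/- **Theorem 5.** For $d\ge 1$, $\sigma>0$ and $\theta\in\mathbb R^d$, let $\mathbf E_\theta$ denote the expectation when $y=(y_1,\dots,y_d)$ is observed, where $y_j=\theta_j+\sigma\xi_j$ and $\xi_1,\dots,\xi_d$ are i.i.d. standard normal. Let $Q(\theta)=\sum_{i=1}^d\theta_i^2$, for $q,r>0$ let $B_q(r)=\{\theta\in\mathbb R^d:\ (\sum_{i=1}^d|\theta_i|^q)^{1/q}\le r\}$, and let $$R_Q^*(B_q(r))=\inf_{\hat T}\ \sup_{\theta\in B_q(r)}\mathbf E_\theta\big(\hat T-Q(\theta)\big)^2,$$ where the infimum is over all estimators, i.e. all measurable functions $\hat T=\hat T(y)\in\mathbb R$. Let $m=m(d,r,\sigma,q)\in\{0,1,2,\dots\}\cup\{\infty\}$ be the largest integer $s\ge 0$ such that $$\sigma^2\log(1+d/k^2)\le r^2k^{-2/q}\qquad\text{for every integer } k \text{ with } 1\le k\le s,$$ with $m=\infty$ if this inequality holds for every integer $k\ge1$ (so $m=0$ if it fails for $k=1$). Put $$\psi^Q_{\sigma,q}(r,d)=\begin{cases}\max\{\sigma^2r^2,\ \sigma^4d\}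 & \text{if } m>\sqrt d,\\ \max\{\sigma^2r^2,\ \sigma^4m^2\log^2(1+d/m^2)\} & \text{if } 1\le m\le\sqrt d,\\ r^4 & \text{if } m=0.\end{cases}$$ Let $0<q<2$. Then there exists a constant $c>0$, depending only on $q$, such that for every integer $d\ge1$ and all $r,\sigma>0$, $$R_Q^*(B_q(r))\ \ge\ c\,\psi^Q_{\sigma,q}(r,d).$$ -/

import Mathlib

open MeasureTheory ProbabilityTheory
open scoped ENNReal

noncomputable section

namespace SparseSequence

/-- The quadratic functional `Q(θ) = ∑ θ_i²`. -/
def quadFunctional {d : ℕ} (θ : Fin d → ℝ) : ℝ := ∑ i, θ i ^ 2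

/-- The `ℓ_q` ball `B_q(r) = {θ ∈ ℝ^d : ‖θ‖_q ≤ r}` with `‖θ‖_q = (∑ |θ_i|^q)^{1/q}`. -/
def lqBall (d : ℕ) (q r : ℝ) : Set (Fin d → ℝ) :=
  {θ | (∑ i, |θ i| ^ q) ^ (1 / q) ≤ r}

/-- `P_θ`, the law of the observation `y = (y_1, …, y_d)`, `y_j = θ_j + σ ξ_j` with `ξ_j` i.i.d.
standard normal: it is the law of `θ + σ ξ` when `ξ` has the standard normal law on `ℝ^d`. -/
def obsLaw {d : ℕ} (σ : ℝ) (θ : Fin d → ℝ) : Measure (Fin d → ℝ) :=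
  (Measure.pi fun _ : Fin d => gaussianReal 0 1).map fun ξ j => θ j + σ * ξ j

/-- The squared risk `E_θ (T̂ - T(θ))²`, as a value in `[0, ∞]`. -/
def sqRisk {d : ℕ} (σ : ℝ) (T : (Fin d → ℝ) → ℝ) (That : (Fin d → ℝ) → ℝ) (θ : Fin d → ℝ) :
    ℝ≥0∞ :=
  ∫⁻ y, ENNReal.ofReal ((That y - T θ) ^ 2) ∂(obsLaw σ θ)

/-- The minimax risk `R*_T(Θ) = inf_{T̂} sup_{θ ∈ Θ} E_θ (T̂ - T(θ))²`, the infimum being over all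
estimators, that is, all measurable real functions of the observation. -/
def minimaxRisk {d : ℕ} (σ : ℝ) (T : (Fin d → ℝ) → ℝ) (Θ : Set (Fin d → ℝ)) : ℝ≥0∞ :=
  ⨅ (That : (Fin d → ℝ) → ℝ) (_ : Measurable That), ⨆ θ ∈ Θ, sqRisk σ T That θ

/-- The inequality `σ² log(1 + d/s²) ≤ r² s^{-2/q}` that defines the effective sparsity. -/
def SparsityIneq (σ q r : ℝ) (d s : ℕ) : Prop :=
  σ ^ 2 * Real.log (1 + (d : ℝ) / (s : ℝ) ^ 2) ≤ r ^ 2 * (s : ℝ) ^ (-(2 / q))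

/-- The effective sparsity `m`: the largest integer `s ≥ 0` such that the inequality holds at
every integer `k` with `1 ≤ k ≤ s`, and `m = ∞` if it holds at every integer `k ≥ 1`.
In particular `m = 0` when it fails at `1`. For `q < 1` the function
`s ↦ s^{2/q} log(1 + d/s²)` increases to infinity, and `m` is the largest `s ≥ 1` that satisfies
the inequality (`0` if there is none). -/
def effSparsity (σ q r : ℝ) (d : ℕ) : ℕ∞ :=
  ⨆ s ∈ {s : ℕ | ∀ k : ℕ, 1 ≤ k → k ≤ s → SparsityIneq σ q r d k}, (s : ℕ∞)

open Classical in
/-- The rate `ψ^Q_{σ,q}(r,d)`: `r⁴` in the degenerate zone `m = 0`, `max(σ² r², σ⁴ d)` in the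
dense zone `m > √d`, and `max(σ² r², σ⁴ m² log²(1 + d/m²))` in the sparse zone `1 ≤ m ≤ √d`
(where `m` is finite, so that `m.toNat` is `m`). -/
def quadRate (σ q r : ℝ) (d : ℕ) : ℝ :=
  let m : ℕ∞ := effSparsity σ q r d
  if m = 0 then r ^ 4
  else if ENNReal.ofReal (√(d : ℝ)) < (m : ℝ≥0∞) then max (σ ^ 2 * r ^ 2) (σ ^ 4 * d)
  else max (σ ^ 2 * r ^ 2)
    (σ ^ 4 * (m.toNat : ℝ) ^ 2 * Real.log (1 + (d : ℝ) / (m.toNat : ℝ) ^ 2) ^ 2)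

end SparseSequence

end

noncomputable section

namespace SparseSequence

/-! Two fuzzy hypotheses: compare a point `θ₀` with a uniform mixture of points where the functional
differs from its value at `θ₀` by at least `Δ`. If the likelihood ratio of the mixture has second
moment at most `C²` under `θ₀`, Cauchy–Schwarz bounds the risk below by `Δ² / (1 + C)²`
(`le_minimaxRisk_of_mixture`). For Gaussian shifts this moment is an average of exponentials of
inner products (`lintegral_piShiftDensity_mul`).

With `θ₀ = 0`, the prior puts a spike of height `a` at an independent uniform position in each of
`s` disjoint blocks of length `b`. The second moment is then `(1 + (exp (a² / σ²) - 1) / b) ^ s`,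
bounded once `s * (exp (a² / σ²) - 1) ≤ 2 * b`, while `Q` moves from `0` to `s * a²`
(`le_minimaxRisk_of_blocks`). Taking `a² = σ² log (1 + d / s²)` and `b = ⌊d / s⌋` meets this
condition, and the sparsity inequality at `s` says exactly that the spikes fit in the ball. The
choice `s = m` gives the sparse rate and `s = ⌊√d⌋` the dense one; for `m = 0`, a single spike of
height `r` gives `r⁴`. The term `σ² r²` comes from two points on one axis at distance `σ / 2`. -/

/-! ### Gaussian shifts -/

/-- Tonelli's theorem for a product of functions of one coordinate each. -/
theorem lintegral_pi_prod_eq_prod {d : ℕ} (μ : Fin d → Measure ℝ) [∀ i, SigmaFinite (μ i)]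
    (f : Fin d → ℝ → ℝ≥0∞) (hf : ∀ i, Measurable (f i)) :
    ∫⁻ x, ∏ i, f i (x i) ∂(Measure.pi μ) = ∏ i, ∫⁻ x, f i x ∂(μ i) := by
  induction d with
  | zero => simp
  | succ n ih =>
    have hmeas : Measurable fun x : Fin n → ℝ => ∏ i, f i.succ (x i) :=
      Finset.measurable_fun_prod _ fun i _ => (hf _).comp (measurable_pi_apply i)
    rw [← ((measurePreserving_piFinSuccAbove μ 0).symm).lintegral_comp_emb
      (MeasurableEquiv.measurableEmbedding _)]
    simp only [MeasurableEquiv.piFinSuccAbove_symm_apply, Fin.insertNthEquiv,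
      Fin.prod_univ_succ, Equiv.coe_fn_mk, Fin.insertNth_zero, Fin.cons_succ,
      Fin.zero_succAbove, Fin.cons_zero]
    rw [← ih (fun i => μ i.succ) (fun i => f i.succ) fun i => hf _,
      ← lintegral_prod_mul (hf 0).aemeasurable hmeas.aemeasurable]
    rfl

/-- The density of `N(v, 1)` with respect to `N(0, 1)`. -/
def shiftDensity (v x : ℝ) : ℝ≥0∞ := ENNReal.ofReal (Real.exp (v * x - v ^ 2 / 2))

theorem measurable_shiftDensity (v : ℝ) : Measurable (shiftDensity v) := by
  unfold shiftDensity
  fun_prop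

theorem gaussianReal_eq_withDensity_shiftDensity (v : ℝ) :
    gaussianReal v 1 = (gaussianReal 0 1).withDensity (shiftDensity v) := by
  rw [gaussianReal_of_var_ne_zero _ one_ne_zero, gaussianReal_of_var_ne_zero _ one_ne_zero,
    ← withDensity_mul _ (measurable_gaussianPDF _ _) (measurable_shiftDensity v)]
  congr 1
  ext x
  simp only [Pi.mul_apply, gaussianPDF, shiftDensity]
  rw [← ENNReal.ofReal_mul (gaussianPDFReal_nonneg 0 1 x)]
  simp only [gaussianPDFReal]
  rw [mul_assoc _⁻¹, ← Real.exp_add]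
  congr 3
  norm_num
  ring

/-- The density of the standard Gaussian law translated by `v`, with respect to the standard
Gaussian law. -/
def piShiftDensity {d : ℕ} (v x : Fin d → ℝ) : ℝ≥0∞ := ∏ i, shiftDensity (v i) (x i)

theorem measurable_piShiftDensity {d : ℕ} (v : Fin d → ℝ) : Measurable (piShiftDensity v) :=
  Finset.measurable_fun_prod _ fun i _ =>
    (measurable_shiftDensity (v i)).comp (measurable_pi_apply i)

theorem map_add_stdGaussian {d : ℕ} (v : Fin d → ℝ) :
    (Measure.pi fun _ : Fin d => gaussianReal 0 1).map (fun ξ j => v j + ξ j) =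
      (Measure.pi fun _ : Fin d => gaussianReal 0 1).withDensity (piShiftDensity v) := by
  have h1 : (Measure.pi fun _ : Fin d => gaussianReal 0 1).map (fun ξ j => v j + ξ j) =
      Measure.pi fun j => gaussianReal (v j) 1 := by
    rw [Measure.pi_map_pi (f := fun j x => v j + x) fun j => by fun_prop]
    congr 1
    ext1 j
    rw [gaussianReal_map_const_add, zero_add]
  rw [h1]
  refine Measure.pi_eq fun s hs => ?_
  rw [withDensity_apply _ (MeasurableSet.univ_pi hs), Measure.restrict_pi_pi]
  unfold piShiftDensity
  rw [lintegral_pi_prod_eq_prod _ _ fun i => measurable_shiftDensity (v i)]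
  refine Finset.prod_congr rfl fun i _ => ?_
  rw [gaussianReal_eq_withDensity_shiftDensity (v i), withDensity_apply _ (hs i)]

theorem lintegral_piShiftDensity {d : ℕ} (v : Fin d → ℝ) :
    ∫⁻ x, piShiftDensity v x ∂(Measure.pi fun _ : Fin d => gaussianReal 0 1) = 1 := by
  have h := congrArg (fun μ : Measure (Fin d → ℝ) => μ Set.univ) (map_add_stdGaussian v)
  simp only [withDensity_apply _ MeasurableSet.univ, Measure.restrict_univ] at h
  rw [← h, Measure.map_apply (by fun_prop) MeasurableSet.univ]
  simp

/-- Completing the square: the product of the two densities is `exp ⟨v, w⟩` times the density of the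
shift by `v + w`, which integrates to one. -/
theorem lintegral_piShiftDensity_mul {d : ℕ} (v w : Fin d → ℝ) :
    ∫⁻ x, piShiftDensity v x * piShiftDensity w x
      ∂(Measure.pi fun _ : Fin d => gaussianReal 0 1) =
      ENNReal.ofReal (Real.exp (∑ i, v i * w i)) := by
  have h (x : Fin d → ℝ) : piShiftDensity v x * piShiftDensity w x =
      ENNReal.ofReal (Real.exp (∑ i, v i * w i)) * piShiftDensity (fun i => v i + w i) x := by
    unfold piShiftDensity shiftDensity
    rw [Real.exp_sum, ENNReal.ofReal_prod_of_nonneg fun i _ => (Real.exp_pos _).le,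
      ← Finset.prod_mul_distrib, ← Finset.prod_mul_distrib]
    refine Finset.prod_congr rfl fun i _ => ?_
    rw [← ENNReal.ofReal_mul (Real.exp_pos _).le, ← ENNReal.ofReal_mul (Real.exp_pos _).le,
      ← Real.exp_add, ← Real.exp_add]
    congr 2
    ring
  simp_rw [h]
  rw [lintegral_const_mul _ (measurable_piShiftDensity _), lintegral_piShiftDensity, mul_one]

/-- Change of measure to the law at `θ₀`: expectations under different `θ` become integrals over one
Gaussian space and can be summed. -/
theorem lintegral_obsLaw {d : ℕ} {σ : ℝ} (hσ : 0 < σ) (θ₀ θ : Fin d → ℝ)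
    {f : (Fin d → ℝ) → ℝ≥0∞} (hf : Measurable f) :
    ∫⁻ y, f y ∂(obsLaw σ θ) =
      ∫⁻ x, f (fun j => θ₀ j + σ * x j) * piShiftDensity (fun j => (θ j - θ₀ j) / σ) x
        ∂(Measure.pi fun _ : Fin d => gaussianReal 0 1) := by
  have hg : Measurable fun x : Fin d → ℝ => f fun j => θ₀ j + σ * x j :=
    hf.comp (by fun_prop)
  have h := lintegral_withDensity_eq_lintegral_mul
    (Measure.pi fun _ : Fin d => gaussianReal 0 1)
    (measurable_piShiftDensity fun j => (θ j - θ₀ j) / σ) hg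
  rw [← map_add_stdGaussian, lintegral_map hg (by fun_prop)] at h
  unfold obsLaw
  rw [lintegral_map hf (by fun_prop)]
  refine Eq.trans (lintegral_congr fun x => ?_) (h.trans (lintegral_congr fun x => mul_comm _ _))
  congr 1
  ext j
  field_simp
  ring

theorem lintegral_obsLaw_self {d : ℕ} (σ : ℝ) (θ : Fin d → ℝ)
    {f : (Fin d → ℝ) → ℝ≥0∞} (hf : Measurable f) :
    ∫⁻ y, f y ∂(obsLaw σ θ) =
      ∫⁻ x, f (fun j => θ j + σ * x j) ∂(Measure.pi fun _ : Fin d => gaussianReal 0 1) :=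
  lintegral_map hf (by fun_prop)

instance isProbabilityMeasure_obsLaw {d : ℕ} (σ : ℝ) (θ : Fin d → ℝ) :
    IsProbabilityMeasure (obsLaw σ θ) :=
  Measure.isProbabilityMeasure_map
    (show Measurable fun (ξ : Fin d → ℝ) j => θ j + σ * ξ j by fun_prop).aemeasurable

/-! ### Two fuzzy hypotheses -/

theorem lintegral_mul_le_sqrt_mul_sqrt {α : Type*} [MeasurableSpace α] (μ : Measure α)
    {f g : α → ℝ≥0∞} (hf : Measurable f) (hg : Measurable g) :
    ∫⁻ x, f x * g x ∂μ ≤ (∫⁻ x, f x ^ 2 ∂μ) ^ (1 / 2 : ℝ) * (∫⁻ x, g x ^ 2 ∂μ) ^ (1 / 2 : ℝ) := by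
  have h := ENNReal.lintegral_mul_le_Lp_mul_Lq μ Real.HolderConjugate.two_two
    hf.aemeasurable hg.aemeasurable
  simpa using h

theorem ofReal_abs_sq (x : ℝ) : ENNReal.ofReal |x| ^ 2 = ENNReal.ofReal (x ^ 2) := by
  rw [← ENNReal.ofReal_pow (abs_nonneg x), sq_abs]

/-- Lower bound for the minimax risk from a simple hypothesis `θ₀` and a uniform mixture of the
`θ i`, when the functional is separated by `Δ` and the second moment of the likelihood ratio is at
most `C²`. -/
theorem le_minimaxRisk_of_mixture {d : ℕ} {ι : Type*} [Fintype ι] [Nonempty ι] {σ : ℝ}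
    (hσ : 0 < σ) (T : (Fin d → ℝ) → ℝ) (Θ : Set (Fin d → ℝ)) (θ₀ : Fin d → ℝ)
    (θ : ι → Fin d → ℝ) (h₀ : θ₀ ∈ Θ) (hθ : ∀ i, θ i ∈ Θ) {Δ C : ℝ} (hC : 0 ≤ C)
    (hΔ0 : 0 ≤ Δ) (hΔ : ∀ i, Δ ≤ |T (θ i) - T θ₀|)
    (hχ : ∑ i, ∑ j, Real.exp (∑ k, (θ i k - θ₀ k) / σ * ((θ j k - θ₀ k) / σ)) ≤
      (C * Fintype.card ι) ^ 2) :
    ENNReal.ofReal (Δ ^ 2 / (1 + C) ^ 2) ≤ minimaxRisk σ T Θ := by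
  refine le_iInf₂ fun That hThat => ?_
  set R : ℝ≥0∞ := ⨆ θ ∈ Θ, sqRisk σ T That θ with hR
  set S : ℝ≥0∞ := R ^ (1 / 2 : ℝ) with hS
  set γ := Measure.pi fun _ : Fin d => gaussianReal 0 1
  set N : ℕ := Fintype.card ι with hN
  have hN0 : 0 < N := Fintype.card_pos
  have hrisk (θ' : Fin d → ℝ) (h : θ' ∈ Θ) :
      ∫⁻ y, ENNReal.ofReal |That y - T θ'| ^ 2 ∂(obsLaw σ θ') ≤ R := by
    simp_rw [ofReal_abs_sq]
    exact le_iSup₂ (f := fun θ _ => sqRisk σ T That θ) θ' h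
  have hm (t : ℝ) : Measurable fun y => ENNReal.ofReal |That y - t| := by
    fun_prop
  let e : (Fin d → ℝ) → ℝ≥0∞ := fun x => ENNReal.ofReal |That (fun j => θ₀ j + σ * x j) - T θ₀|
  have he : Measurable e := (hm (T θ₀)).comp (by fun_prop)
  have he2 : ∫⁻ x, e x ^ 2 ∂γ ≤ R := by
    have := hrisk θ₀ h₀
    rwa [lintegral_obsLaw_self _ _ ((hm _).pow_const 2)] at this
  let G : ι → (Fin d → ℝ) → ℝ≥0∞ := fun i => piShiftDensity fun j => (θ i j - θ₀ j) / σ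
  have hG (i : ι) : Measurable (G i) := measurable_piShiftDensity _
  -- An estimate cannot be close to both `T θ₀` and `T (θ i)`. The error around `T (θ i)` costs at
  -- most the root risk `S`; the other is moved to the law at `θ₀`.
  have hsep (i : ι) : ENNReal.ofReal Δ ≤ ∫⁻ x, e x * G i x ∂γ + S := by
    have h1 : ∫⁻ y, ENNReal.ofReal |That y - T (θ i)| ∂(obsLaw σ (θ i)) ≤ S := by
      have := lintegral_mul_le_sqrt_mul_sqrt (obsLaw σ (θ i)) (hm (T (θ i)))
        (measurable_const (a := (1 : ℝ≥0∞)))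
      simp only [mul_one, one_pow, lintegral_const, measure_univ, ENNReal.one_rpow] at this
      exact this.trans (ENNReal.rpow_le_rpow (hrisk _ (hθ i)) (by norm_num))
    rw [← lintegral_obsLaw hσ θ₀ (θ i) (hm (T θ₀))]
    calc ENNReal.ofReal Δ = ∫⁻ _, ENNReal.ofReal Δ ∂(obsLaw σ (θ i)) := by simp
      _ ≤ ∫⁻ y, (ENNReal.ofReal |That y - T θ₀| + ENNReal.ofReal |That y - T (θ i)|)
            ∂(obsLaw σ (θ i)) := by
          refine lintegral_mono fun y => ?_
          rw [← ENNReal.ofReal_add (abs_nonneg _) (abs_nonneg _)]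
          refine ENNReal.ofReal_le_ofReal ((hΔ i).trans ?_)
          rw [abs_sub_comm (That y) (T (θ i)), add_comm]
          exact abs_sub_le _ _ _
      _ = ∫⁻ y, ENNReal.ofReal |That y - T θ₀| ∂(obsLaw σ (θ i)) +
            ∫⁻ y, ENNReal.ofReal |That y - T (θ i)| ∂(obsLaw σ (θ i)) :=
          lintegral_add_left (hm _) _
      _ ≤ _ := by gcongr
  have hmix : ∫⁻ x, (∑ i, G i x) ^ 2 ∂γ ≤ ENNReal.ofReal ((C * N) ^ 2) := by
    have h1 (x : Fin d → ℝ) : (∑ i, G i x) ^ 2 = ∑ i, ∑ j, G i x * G j x := by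
      rw [sq, Finset.sum_mul_sum]
    simp_rw [h1]
    rw [lintegral_finsetSum _ fun i _ => Finset.measurable_fun_sum _ fun j _ =>
      (hG i).fun_mul (hG j)]
    refine le_trans (le_of_eq ?_) (ENNReal.ofReal_le_ofReal hχ)
    rw [ENNReal.ofReal_sum_of_nonneg fun i _ => Finset.sum_nonneg fun j _ => (Real.exp_pos _).le]
    refine Finset.sum_congr rfl fun i _ => ?_
    rw [ENNReal.ofReal_sum_of_nonneg fun j _ => (Real.exp_pos _).le,
      lintegral_finsetSum _ fun j _ => (hG i).fun_mul (hG j)]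
    exact Finset.sum_congr rfl fun j _ => lintegral_piShiftDensity_mul _ _
  -- Cauchy–Schwarz is applied only after summing over `i`, so that the second moment of the mixture
  -- enters, not that of each single density.
  have hcross : ∑ i, ∫⁻ x, e x * G i x ∂γ ≤ S * ENNReal.ofReal (C * N) := by
    rw [← lintegral_finsetSum _ fun i _ => he.fun_mul (hG i)]
    simp_rw [← Finset.mul_sum]
    refine (lintegral_mul_le_sqrt_mul_sqrt γ he
      (Finset.measurable_fun_sum _ fun i _ => hG i)).trans ?_
    refine mul_le_mul' (ENNReal.rpow_le_rpow he2 (by norm_num))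
      ((ENNReal.rpow_le_rpow hmix (by norm_num)).trans (le_of_eq ?_))
    rw [ENNReal.ofReal_rpow_of_nonneg (by positivity) (by norm_num), ← Real.sqrt_eq_rpow,
      Real.sqrt_sq (by positivity)]
  have hsum : (N : ℝ≥0∞) * ENNReal.ofReal Δ ≤ N * (S * ENNReal.ofReal (1 + C)) := by
    calc (N : ℝ≥0∞) * ENNReal.ofReal Δ = ∑ _i : ι, ENNReal.ofReal Δ := by simp [hN]
      _ ≤ ∑ i, (∫⁻ x, e x * G i x ∂γ + S) := Finset.sum_le_sum fun i _ => hsep i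
      _ = ∑ i, ∫⁻ x, e x * G i x ∂γ + N * S := by simp [Finset.sum_add_distrib, hN]
      _ ≤ S * ENNReal.ofReal (C * N) + N * S := by gcongr
      _ = _ := by
        rw [ENNReal.ofReal_mul hC, ENNReal.ofReal_natCast, ENNReal.ofReal_add zero_le_one hC,
          ENNReal.ofReal_one]
        ring
  have hfin : ENNReal.ofReal Δ ≤ S * ENNReal.ofReal (1 + C) :=
    (ENNReal.mul_le_mul_iff_right (by exact_mod_cast hN0.ne') (ENNReal.natCast_ne_top N)).1 hsum
  have hsq : ENNReal.ofReal (Δ ^ 2) ≤ R * ENNReal.ofReal ((1 + C) ^ 2) := by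
    have h2 : S ^ 2 = R := by
      rw [hS, ← ENNReal.rpow_natCast, ← ENNReal.rpow_mul]
      norm_num
    rw [ENNReal.ofReal_pow hΔ0, ENNReal.ofReal_pow (by positivity), ← h2, ← mul_pow]
    gcongr
  rw [ENNReal.ofReal_div_of_pos (by positivity)]
  exact ENNReal.div_le_of_le_mul hsq

/-! ### Priors with one spike per block -/

/-- The vector with value `a` at the coordinates `e (l, f l)` and `0` elsewhere. -/
def spikes {d s b : ℕ} (e : Fin s × Fin b ↪ Fin d) (a : ℝ) (f : Fin s → Fin b) : Fin d → ℝ :=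
  fun k => if k ∈ Finset.univ.image (fun l => e (l, f l)) then a else 0

theorem spikes_apply {d s b : ℕ} (e : Fin s × Fin b ↪ Fin d) (a : ℝ) (f : Fin s → Fin b)
    (l : Fin s) (j : Fin b) : spikes e a f (e (l, j)) = if f l = j then a else 0 := by
  unfold spikes
  congr 1
  simp only [Finset.mem_image, Finset.mem_univ, true_and, EmbeddingLike.apply_eq_iff_eq,
    Prod.mk.injEq, eq_iff_iff]
  constructor
  · rintro ⟨l', rfl, h⟩
    exact h
  · exact fun h => ⟨l, rfl, h⟩

/-- Spikes in different blocks never collide, so the support has exactly one coordinate per block.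
-/
theorem sum_spikes {d s b : ℕ} (e : Fin s × Fin b ↪ Fin d) (a : ℝ) (f : Fin s → Fin b)
    (φ : Fin d → ℝ → ℝ) (hφ : ∀ k, φ k 0 = 0) :
    ∑ k, φ k (spikes e a f k) = ∑ l, φ (e (l, f l)) a := by
  have hinj : Function.Injective fun l => e (l, f l) := fun l l' h => by
    simpa using congrArg Prod.fst (e.injective h)
  rw [← Finset.sum_subset (Finset.subset_univ (Finset.univ.image fun l => e (l, f l))),
    Finset.sum_image hinj.injOn]
  · exact Finset.sum_congr rfl fun l _ => by rw [spikes_apply, if_pos rfl]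
  · intro k _ hk
    simp only [spikes, if_neg hk, hφ]

theorem quadFunctional_spikes {d s b : ℕ} (e : Fin s × Fin b ↪ Fin d) (a : ℝ)
    (f : Fin s → Fin b) : quadFunctional (spikes e a f) = s * a ^ 2 := by
  unfold quadFunctional
  rw [sum_spikes e a f (fun _ t => t ^ 2) (by simp)]
  simp

theorem zero_mem_lqBall {d : ℕ} {q r : ℝ} (hq : 0 < q) (hr : 0 ≤ r) :
    (0 : Fin d → ℝ) ∈ lqBall d q r := by
  simp only [lqBall, Set.mem_ofPred_eq, Pi.zero_apply, abs_zero, Real.zero_rpow hq.ne',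
    Finset.sum_const_zero]
  rwa [Real.zero_rpow (by positivity)]

theorem spikes_mem_lqBall {d s b : ℕ} (e : Fin s × Fin b ↪ Fin d) {a q r : ℝ} (hq : 0 < q)
    (ha : 0 ≤ a) (h : (s : ℝ) ^ (1 / q) * a ≤ r) (f : Fin s → Fin b) :
    spikes e a f ∈ lqBall d q r := by
  simp only [lqBall, Set.mem_ofPred_eq]
  rw [sum_spikes e a f (fun _ t => |t| ^ q) (by simp [hq.ne'])]
  simp only [Finset.sum_const, Finset.card_univ, Fintype.card_fin, nsmul_eq_mul]
  rw [Real.mul_rpow (by positivity) (by positivity), ← Real.rpow_mul (abs_nonneg a),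
    mul_one_div_cancel hq.ne', Real.rpow_one, abs_of_nonneg ha]
  exact h

/-- The inner product is `a² / σ²` times the number of blocks where `f` and `g` agree. Its
exponential is a product over blocks, so the sum over `g` factors, whatever `f` is. -/
theorem sum_exp_spikes {d s b : ℕ} (e : Fin s × Fin b ↪ Fin d) (a σ : ℝ) :
    ∑ f : Fin s → Fin b, ∑ g : Fin s → Fin b,
      Real.exp (∑ k, spikes e a f k / σ * (spikes e a g k / σ)) =
      (b * (b + (Real.exp (a ^ 2 / σ ^ 2) - 1))) ^ s := by
  have h (f g : Fin s → Fin b) : Real.exp (∑ k, spikes e a f k / σ * (spikes e a g k / σ)) =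
      ∏ l, if g l = f l then Real.exp (a ^ 2 / σ ^ 2) else 1 := by
    rw [sum_spikes e a f (fun k t => t / σ * (spikes e a g k / σ)) (by simp), Real.exp_sum]
    refine Finset.prod_congr rfl fun l _ => ?_
    rw [spikes_apply]
    split_ifs
    · congr 1
      ring
    · simp
  have h2 (j : Fin b) : ∑ i : Fin b, (if i = j then Real.exp (a ^ 2 / σ ^ 2) else 1) =
      b + (Real.exp (a ^ 2 / σ ^ 2) - 1) := by
    have : ∀ i : Fin b, (if i = j then Real.exp (a ^ 2 / σ ^ 2) else 1) =
        1 + if i = j then Real.exp (a ^ 2 / σ ^ 2) - 1 else 0 := fun i => by split_ifs <;> ring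
    simp_rw [this]
    simp [Finset.sum_add_distrib]
  simp_rw [h]
  have h3 (f : Fin s → Fin b) :
      ∑ g : Fin s → Fin b, ∏ l, (if g l = f l then Real.exp (a ^ 2 / σ ^ 2) else 1) =
        (b + (Real.exp (a ^ 2 / σ ^ 2) - 1)) ^ s := by
    rw [← Fintype.prod_sum fun l j => if j = f l then Real.exp (a ^ 2 / σ ^ 2) else 1]
    simp [h2]
  simp_rw [h3]
  simp [mul_pow]

theorem le_minimaxRisk_of_blocks {d s b : ℕ} (hb : 1 ≤ b) (hsb : s * b ≤ d) {a q r σ : ℝ}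
    (hσ : 0 < σ) (hq : 0 < q) (hr : 0 ≤ r) (ha : 0 ≤ a) (har : (s : ℝ) ^ (1 / q) * a ≤ r)
    (hχ : s * (Real.exp (a ^ 2 / σ ^ 2) - 1) ≤ 2 * b) :
    ENNReal.ofReal ((s * a ^ 2) ^ 2 / (1 + Real.exp 1) ^ 2) ≤
      minimaxRisk σ quadFunctional (lqBall d q r) := by
  let e : Fin s × Fin b ↪ Fin d := finProdFinEquiv.toEmbedding.trans (Fin.castLEEmb hsb)
  have : Nonempty (Fin b) := ⟨⟨0, hb⟩⟩
  have hb0 : (0 : ℝ) < b := by exact_mod_cast hb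
  refine le_minimaxRisk_of_mixture hσ quadFunctional _ 0 (spikes e a) (zero_mem_lqBall hq hr)
    (spikes_mem_lqBall e hq ha har) (Real.exp_pos 1).le (by positivity) (fun f => ?_) ?_
  · rw [quadFunctional_spikes]
    simp only [quadFunctional, Pi.zero_apply]
    norm_num
  · simp only [Pi.zero_apply, sub_zero]
    rw [sum_exp_spikes]
    set E := Real.exp (a ^ 2 / σ ^ 2) - 1 with hE
    have hE0 : 0 ≤ E := by
      rw [hE, sub_nonneg]
      exact Real.one_le_exp (by positivity)
    -- From `1 + x ≤ exp x`; the `s`-th power then contributes `exp (s * E / b) ≤ exp 2`, whence `C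
    -- = exp 1`.
    have h1 : b + E ≤ b * Real.exp (E / b) := by
      have := Real.add_one_le_exp (E / b)
      calc b + E = b * (E / b + 1) := by field_simp; ring
        _ ≤ _ := by gcongr
    have h2 : Real.exp (E / b) ^ s ≤ Real.exp 1 ^ 2 := by
      rw [← Real.exp_nat_mul, ← Real.exp_nat_mul]
      refine Real.exp_le_exp.2 ?_
      rw [← mul_div_assoc, div_le_iff₀ hb0]
      simpa using hχ
    calc (b * (b + E)) ^ s ≤ (b * (b * Real.exp (E / b))) ^ s := by gcongr
      _ = ((b : ℝ) ^ s) ^ 2 * Real.exp (E / b) ^ s := by ring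
      _ ≤ ((b : ℝ) ^ s) ^ 2 * Real.exp 1 ^ 2 := by gcongr
      _ = _ := by
        simp only [Fintype.card_pi, Fintype.card_fin, Finset.prod_const, Finset.card_univ,
          Nat.cast_pow]
        ring

/-! ### The three regimes -/

/-- Failure at `1` gives `exp (r² / σ²) ≤ 1 + d`: a spike of full height `r` at a uniform position
among all `d` coordinates is not reliably detectable. -/
theorem le_minimaxRisk_of_not_sparsityIneq_one {d : ℕ} {q r σ : ℝ} (hd : 1 ≤ d) (hq : 0 < q)
    (hr : 0 < r) (hσ : 0 < σ) (h : ¬ SparsityIneq σ q r d 1) :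
    ENNReal.ofReal (r ^ 4 / (1 + Real.exp 1) ^ 2) ≤
      minimaxRisk σ quadFunctional (lqBall d q r) := by
  have hlog : r ^ 2 / σ ^ 2 ≤ Real.log (1 + d) := by
    simp only [SparsityIneq, Nat.cast_one, one_pow, div_one, Real.one_rpow, mul_one, not_le] at h
    rw [div_le_iff₀ (by positivity), mul_comm]
    exact h.le
  have hexp : Real.exp (r ^ 2 / σ ^ 2) ≤ 1 + d :=
    (Real.le_log_iff_exp_le (by positivity)).1 hlog
  have := le_minimaxRisk_of_blocks (d := d) (s := 1) (b := d) (a := r) hd (by simp) hσ hq hr.le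
    hr.le (by simp) (by push_cast; linarith [Nat.cast_nonneg (α := ℝ) d])
  convert this using 3
  push_cast
  ring

theorem le_minimaxRisk_of_sparsityIneq {d s : ℕ} {q r σ : ℝ} (hq : 0 < q) (hr : 0 < r)
    (hσ : 0 < σ) (hs : 1 ≤ s) (hsd : s ^ 2 ≤ d) (h : SparsityIneq σ q r d s) :
    ENNReal.ofReal (σ ^ 4 * s ^ 2 * Real.log (1 + d / s ^ 2) ^ 2 / (1 + Real.exp 1) ^ 2) ≤
      minimaxRisk σ quadFunctional (lqBall d q r) := by
  have hs0 : (0 : ℝ) < s := by exact_mod_cast hs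
  set L := Real.log (1 + d / (s : ℝ) ^ 2) with hL
  have hL0 : 0 ≤ L := Real.log_nonneg (by linarith [show 0 ≤ d / (s : ℝ) ^ 2 by positivity])
  -- This is where `s² ≤ d` is needed: the blocks are nonempty.
  have hb : s ≤ d / s := (Nat.le_div_iff_mul_le hs).2 (by rwa [← sq])
  have ha2 : (σ * √L) ^ 2 = σ ^ 2 * L := by rw [mul_pow, Real.sq_sqrt hL0]
  have har : (s : ℝ) ^ (1 / q) * (σ * √L) ≤ r := by
    refine le_of_abs_le (abs_le_of_sq_le_sq ?_ hr.le)
    rw [mul_pow, ha2, ← Real.rpow_natCast, ← Real.rpow_mul hs0.le]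
    calc (s : ℝ) ^ (1 / q * (2 : ℕ)) * (σ ^ 2 * L)
        ≤ (s : ℝ) ^ (1 / q * (2 : ℕ)) * (r ^ 2 * (s : ℝ) ^ (-(2 / q))) :=
          mul_le_mul_of_nonneg_left h (by positivity)
      _ = r ^ 2 * ((s : ℝ) ^ (1 / q * (2 : ℕ)) * (s : ℝ) ^ (-(2 / q))) := by ring
      _ = r ^ 2 := by
          rw [← Real.rpow_add hs0]
          have : 1 / q * (2 : ℕ) + -(2 / q) = 0 := by push_cast; ring
          rw [this, Real.rpow_zero, mul_one]
  have hχ : s * (Real.exp ((σ * √L) ^ 2 / σ ^ 2) - 1) ≤ 2 * (d / s : ℕ) := by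
    rw [ha2, mul_div_cancel_left₀ _ (by positivity), hL, Real.exp_log (by positivity)]
    have h1 : d < s * (d / s) + s := by
      have := Nat.div_add_mod d s
      have := Nat.mod_lt d hs
      omega
    -- Rounding `d / s` down loses at most a factor `2` because the quotient is at least `1`; the
    -- condition on blocks leaves room for it.
    have h2 : (d : ℝ) ≤ s * (2 * (d / s : ℕ)) := by
      have h3 : d ≤ s * (2 * (d / s)) := by nlinarith
      exact_mod_cast h3
    calc s * (1 + d / (s : ℝ) ^ 2 - 1) = d / s := by field_simp; ring
      _ ≤ _ := by rw [div_le_iff₀ hs0]; linarith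
  have := le_minimaxRisk_of_blocks (d := d) (hs.trans hb) (Nat.mul_div_le d s) hσ hq hr.le
    (by positivity) har hχ
  convert this using 3
  rw [ha2]
  ring

theorem single_mem_lqBall {d : ℕ} {q r : ℝ} (hq : 0 < q) (k : Fin d) {t : ℝ} (ht : |t| ≤ r) :
    (Pi.single k t : Fin d → ℝ) ∈ lqBall d q r := by
  have : ∑ i, |(Pi.single k t : Fin d → ℝ) i| ^ q = |t| ^ q := by
    rw [Finset.sum_eq_single k (fun i _ hi => by simp [hi, hq.ne']) (by simp)]
    simp
  simp only [lqBall, Set.mem_ofPred_eq]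
  rw [this, ← Real.rpow_mul (abs_nonneg t), mul_one_div_cancel hq.ne', Real.rpow_one]
  exact ht

theorem quadFunctional_single {d : ℕ} (k : Fin d) (t : ℝ) :
    quadFunctional (Pi.single k t : Fin d → ℝ) = t ^ 2 := by
  unfold quadFunctional
  rw [Finset.sum_eq_single k (fun i _ hi => by simp [hi]) (by simp)]
  simp

/-- The points `r` and `r - σ / 2` on an axis have `Q` differing by `σ * r - σ² / 4`, and their
likelihood ratio has second moment `exp (1 / 4)`. The sparsity inequality at `1` gives `σ / 2 ≤ r`,
since `log 2 > 1 / 4`; hence the gap is at least `σ * r / 2`. -/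
theorem le_minimaxRisk_of_two_points {d : ℕ} {q r σ : ℝ} (hd : 1 ≤ d) (hq : 0 < q)
    (hr : 0 < r) (hσ : 0 < σ) (h : SparsityIneq σ q r d 1) :
    ENNReal.ofReal ((σ * r / 2) ^ 2 / (1 + Real.exp 1) ^ 2) ≤
      minimaxRisk σ quadFunctional (lqBall d q r) := by
  have hσr : σ / 2 ≤ r := by
    have h1 : Real.log 2 ≤ Real.log (1 + d) := by
      have : (1 : ℝ) ≤ d := by exact_mod_cast hd
      exact Real.log_le_log (by norm_num) (by linarith)
    simp only [SparsityIneq, Nat.cast_one, one_pow, div_one, Real.one_rpow, mul_one] at h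
    refine le_of_abs_le (abs_le_of_sq_le_sq ?_ hr.le)
    nlinarith [Real.log_two_gt_d9, sq_pos_of_pos hσ]
  let k : Fin d := ⟨0, hd⟩
  refine le_minimaxRisk_of_mixture (ι := Unit) hσ quadFunctional _ (Pi.single k (r - σ / 2))
    (fun _ => Pi.single k r) (single_mem_lqBall hq k ?_)
    (fun _ => single_mem_lqBall hq k (abs_of_pos hr).le) (Real.exp_pos 1).le (by positivity)
    (fun _ => ?_) ?_
  · rw [abs_of_nonneg (by linarith)]
    linarith
  · rw [quadFunctional_single, quadFunctional_single]
    refine le_trans ?_ (le_abs_self _)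
    nlinarith
  · simp only [Finset.univ_unique, Finset.sum_singleton]
    rw [Finset.sum_eq_single k (fun i _ hi => by simp [hi]) (by simp)]
    simp only [Pi.single_eq_same, Fintype.card_unique, Nat.cast_one, mul_one]
    rw [← Real.exp_nat_mul]
    refine Real.exp_le_exp.2 ?_
    have : (r - (r - σ / 2)) / σ = 1 / 2 := by field_simp; ring
    rw [this]
    norm_num

/-! ### The effective sparsity -/

theorem sparsityIneq_of_le_effSparsity {σ q r : ℝ} {d s : ℕ} (hs : 1 ≤ s)
    (h : (s : ℕ∞) ≤ effSparsity σ q r d) : SparsityIneq σ q r d s := by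
  -- The supremum may be infinite and not attained; the strict inequality at `s - 1` yields an
  -- actual member `t ≥ s` of the set.
  have h1 : ((s - 1 : ℕ) : ℕ∞) < effSparsity σ q r d :=
    lt_of_lt_of_le (by exact_mod_cast Nat.sub_lt hs one_pos) h
  unfold effSparsity at h1
  obtain ⟨t, ht⟩ := lt_iSup_iff.1 h1
  obtain ⟨hmem, ht⟩ := lt_iSup_iff.1 ht
  have ht' : s - 1 < t := by exact_mod_cast ht
  exact hmem s hs (by omega)

theorem not_sparsityIneq_one_of_effSparsity_eq_zero {σ q r : ℝ} {d : ℕ}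
    (h : effSparsity σ q r d = 0) : ¬ SparsityIneq σ q r d 1 := by
  intro h1
  have h2 : ((1 : ℕ) : ℕ∞) ≤ effSparsity σ q r d := by
    refine le_iSup₂ (f := fun (s : ℕ) (_ : s ∈ {s : ℕ | ∀ k : ℕ, 1 ≤ k → k ≤ s →
      SparsityIneq σ q r d k}) => (s : ℕ∞)) 1 ?_
    intro k hk hk1
    obtain rfl : k = 1 := le_antisymm hk1 hk
    exact h1
  simp [h] at h2

theorem ofReal_mul_max_le {c x y : ℝ} {R : ℝ≥0∞} (hc : 0 ≤ c) (hx : ENNReal.ofReal (c * x) ≤ R)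
    (hy : ENNReal.ofReal (c * y) ≤ R) : ENNReal.ofReal (c * max x y) ≤ R := by
  rw [mul_max_of_nonneg _ _ hc, ENNReal.ofReal_max]
  exact max_le hx hy

end SparseSequence

end

open SparseSequence in
theorem theorem5 (q : ℝ) (hq0 : 0 < q) (hq2 : q < 2) :
    ∃ c : ℝ, 0 < c ∧ ∀ (d : ℕ) (r σ : ℝ), 1 ≤ d → 0 < r → 0 < σ →
      ENNReal.ofReal (c * SparseSequence.quadRate σ q r d) ≤
        SparseSequence.minimaxRisk σ SparseSequence.quadFunctional
          (SparseSequence.lqBall d q r) := by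
  set K : ℝ := (1 + Real.exp 1) ^ 2 with hK
  have hK0 : 0 < K := by positivity
  have hlog0 : 0 < Real.log 2 := Real.log_pos (by norm_num)
  have hlog1 : Real.log 2 ^ 2 ≤ 1 := pow_le_one₀ hlog0.le (by linarith [Real.log_two_lt_d9])
  -- The factor `4` covers both the halved gap of the two points and `d ≤ 4 * ⌊√d⌋²`; `log 2` bounds
  -- the logarithm below at `s = ⌊√d⌋`.
  refine ⟨Real.log 2 ^ 2 / (4 * K), by positivity, fun d r σ hd hr hσ => ?_⟩
  have hc0 : 0 ≤ Real.log 2 ^ 2 / (4 * K) := by positivity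
  have hc : Real.log 2 ^ 2 / (4 * K) ≤ 1 / (4 * K) := by gcongr
  have hc' : 1 / (4 * K) ≤ 1 / K := by gcongr; linarith
  simp only [quadRate]
  split_ifs with hm0 hmd
  · refine le_trans (ENNReal.ofReal_le_ofReal ?_) (le_minimaxRisk_of_not_sparsityIneq_one hd hq0
      hr hσ (not_sparsityIneq_one_of_effSparsity_eq_zero hm0))
    calc _ ≤ 1 / K * r ^ 4 := mul_le_mul_of_nonneg_right (hc.trans hc') (by positivity)
      _ = _ := by rw [hK]; ring
  · have hm1 : SparsityIneq σ q r d 1 := sparsityIneq_of_le_effSparsity le_rfl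
      (by simpa using Order.one_le_iff_pos.2 (pos_iff_ne_zero.2 hm0))
    refine ofReal_mul_max_le hc0 ?_ ?_
    · refine le_trans (ENNReal.ofReal_le_ofReal ?_)
        (le_minimaxRisk_of_two_points hd hq0 hr hσ hm1)
      calc _ ≤ 1 / (4 * K) * (σ ^ 2 * r ^ 2) := by gcongr
        _ = _ := by rw [← hK]; field_simp; norm_num
    · have hs1 : 1 ≤ d.sqrt := Nat.sqrt_pos.2 hd
      have hsd : d.sqrt ^ 2 ≤ d := Nat.sqrt_le' d
      have hsm : (d.sqrt : ℕ∞) ≤ effSparsity σ q r d := by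
        have h1 : ((d.sqrt : ℕ∞) : ℝ≥0∞) ≤ (effSparsity σ q r d : ℝ≥0∞) := by
          refine le_trans ?_ hmd.le
          rw [ENat.toENNReal_coe, ← ENNReal.ofReal_natCast]
          exact ENNReal.ofReal_le_ofReal Real.nat_sqrt_le_real_sqrt
        exact ENat.toENNReal_le.1 h1
      refine le_trans (ENNReal.ofReal_le_ofReal ?_) (le_minimaxRisk_of_sparsityIneq hq0 hr hσ hs1
        hsd (sparsityIneq_of_le_effSparsity hs1 hsm))
      have hs0 : (0 : ℝ) < d.sqrt := by exact_mod_cast hs1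
      have hL : Real.log 2 ≤ Real.log (1 + d / (d.sqrt : ℝ) ^ 2) := by
        refine Real.log_le_log (by norm_num) ?_
        have : 1 ≤ d / (d.sqrt : ℝ) ^ 2 := by
          rw [le_div_iff₀ (by positivity), one_mul]
          exact_mod_cast hsd
        linarith
      have hd4 : (d : ℝ) ≤ 4 * (d.sqrt : ℝ) ^ 2 := by
        have h1 : d < (d.sqrt + 1) ^ 2 := Nat.lt_succ_sqrt' d
        have h2 : d ≤ 4 * d.sqrt ^ 2 := by nlinarith
        exact_mod_cast h2
      calc Real.log 2 ^ 2 / (4 * K) * (σ ^ 4 * d)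
          ≤ Real.log 2 ^ 2 / (4 * K) * (σ ^ 4 * (4 * (d.sqrt : ℝ) ^ 2)) := by gcongr
        _ = σ ^ 4 * (d.sqrt : ℝ) ^ 2 * Real.log 2 ^ 2 / K := by field_simp
        _ ≤ _ := by gcongr
  · have hm1 : SparsityIneq σ q r d 1 := sparsityIneq_of_le_effSparsity le_rfl
      (by simpa using Order.one_le_iff_pos.2 (pos_iff_ne_zero.2 hm0))
    refine ofReal_mul_max_le hc0 ?_ ?_
    · refine le_trans (ENNReal.ofReal_le_ofReal ?_)
        (le_minimaxRisk_of_two_points hd hq0 hr hσ hm1)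
      calc _ ≤ 1 / (4 * K) * (σ ^ 2 * r ^ 2) := by gcongr
        _ = _ := by rw [← hK]; field_simp; norm_num
    · have hle := not_lt.1 hmd
      -- Here `m ≤ √d` excludes `m = ∞`, so `toNat` returns the true value and not its default `0`.
      obtain ⟨m, hm⟩ : ∃ m : ℕ, effSparsity σ q r d = m := by
        refine (ENat.ne_top_iff_exists.1 fun htop => ?_).imp fun _ => Eq.symm
        rw [htop] at hle
        simp at hle
      rw [hm] at hle hm0 ⊢
      simp only [ENat.toNat_natCast]
      have hs1 : 1 ≤ m := Nat.one_le_iff_ne_zero.2 (by exact_mod_cast hm0)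
      have hsd : m ^ 2 ≤ d := by
        rw [ENat.toENNReal_coe, ← ENNReal.ofReal_natCast,
          ENNReal.ofReal_le_ofReal_iff (Real.sqrt_nonneg _)] at hle
        have := (Real.le_sqrt' (by exact_mod_cast hs1)).1 hle
        exact_mod_cast this
      refine le_trans (ENNReal.ofReal_le_ofReal ?_) (le_minimaxRisk_of_sparsityIneq hq0 hr hσ hs1
        hsd (sparsityIneq_of_le_effSparsity hs1 hm.ge))
      calc _ ≤ 1 / K * (σ ^ 4 * (m : ℝ) ^ 2 * Real.log (1 + d / (m : ℝ) ^ 2) ^ 2) := 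
            mul_le_mul_of_nonneg_right (hc.trans hc') (by positivity)
        _ = _ := by rw [hK]; ring
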